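/- Fix an integer $K\ge 1$ (the number of classes). For $p\in[0,1]$ let $\sigma(p)=p\log p+(1-p)\log(1-p)$, with $0\log 0=0$. **Model.** Let $N$ be the number of nodes, $c\in\{1,\dots,K\}^N$ the true labels, and $(P^t)_{t\ge1}$ a sequence of symmetric matrices in $[0,1]^{K\times K}$. The layers $G^1,G^2,\dots$ are random simple undirected graphs on $\{1,\dots,N\}$ (no self-edges); all edge indicators $G^t_{ij}$ ($t\ge 1$, $i<j$) are independent and $\Pr(G^t_{ij}=1)=P^t_{c_ic_j}$. **Profile log-likelihood.** For $z\in\{1,\dots,K\}^N$ let $n_k(z)=\#\{i:z_i=k\}$ and $m(z)=\min_k n_k(z)$; let $n_{kl}(z)=n_k(z)n_l(z)$ for $k\ne l$ and $n_{kk}(z)=n_k(z)(n_k(z)-1)/2$; let $o^t_{kl}(z)$ be the number of edges of $G^t$ in block $(k,l)$, that is $o^t_{kl}(z)=\sum_{i:z_i=k}\sum_{j:z_j=l}G^t_{ij}$ for $k\neq l$, and half of this sum for $k=l$. Put $$f^t(z)=\sum_{k\le l} n_{kl}(z)\,\sigma\!\left(\frac{o^t_{kl}(z)}{n_{kl}(z)}\right),$$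 where blocks with $n_{kl}(z)=0$ contribute $0$. **Constants.** Let $$C_0=\inf_{t,k,l}\min\bigl(P^t_{kl},\,1-P^t_{kl}\bigr),\qquad \delta=\inf_{t,\;k\ne l}\ \max_{m}\Bigl[\sigma(P^t_{km})+\sigma(P^t_{lm})-2\sigma\Bigl(\frac{P^t_{km}+P^t_{lm}}{2}\Bigr)\Bigr]$$ (with $\delta=+\infty$ if $K=1$). **Theorem.** For all reals $c_0>0$ and $d_0>0$ there is an integer $m_0$, depending only on $K$, $c_0$ and $d_0$, such that the following holds for all $N$, $c$, $(P^t)$ and $(G^t)$ as above. If $C_0\ge c_0$, $\delta\ge d_0$ and $m(c)\ge m_0$, then, as $T\to\infty$, $\hat c=\operatorname{argmax}_z\sum_{t=1}^T f^t(z)$ converges almost surely to $c$ up to a permutation of the class labels: almost surely there is $T_0$ such that for all $T\ge T_0$ the set of maximizers of $z\mapsto\sum_{t=1}^Tf^t(z)$ over $\{1,\dots,K\}^N$ is exactly $\{\pi\circ c:\pi\text{ a permutation of }\{1,\dots,K\}\}$. -/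

import Mathlib

open MeasureTheory ProbabilityTheory Filter

namespace MultiSBM

/-- `σ(p) = p log p + (1 - p) log (1 - p)`, with `0 log 0 = 0`. -/
noncomputable def sigma (p : ℝ) : ℝ :=
  p * Real.log p + (1 - p) * Real.log (1 - p)

/-- The constant `C_0 = inf_{t,k,l} min (P^t_{kl}, 1 - P^t_{kl})`, an infimum in the extended
reals. -/
noncomputable def entryMargin {K : ℕ} (P : ℕ → Matrix (Fin K) (Fin K) ℝ) : EReal :=
  ⨅ (t : ℕ) (k : Fin K) (l : Fin K), ((min (P t k l) (1 - P t k l) : ℝ) : EReal)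

/-- The constant
`δ = inf_{t, k ≠ l} max_m [σ(P^t_{km}) + σ(P^t_{lm}) - 2 σ((P^t_{km} + P^t_{lm}) / 2)]`,
an infimum in the extended reals (so it is `⊤` when there is only one class). -/
noncomputable def separation {K : ℕ} (P : ℕ → Matrix (Fin K) (Fin K) ℝ) : EReal :=
  ⨅ (t : ℕ) (k : Fin K) (l : Fin K) (_ : k ≠ l), ⨆ m : Fin K,
    ((sigma (P t k m) + sigma (P t l m) - 2 * sigma ((P t k m + P t l m) / 2) : ℝ) : EReal)

/-- `n_k(z)`, the number of nodes that the assignment `z` puts in class `k`. -/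
def classSize {N K : ℕ} (z : Fin N → Fin K) (k : Fin K) : ℕ :=
  (Finset.univ.filter fun i => z i = k).card

/-- `m(z) = min_k n_k(z)`, the minimum class size (for `1 ≤ K`). -/
noncomputable def minClassSize {N K : ℕ} (z : Fin N → Fin K) : ℕ :=
  ⨅ k : Fin K, classSize z k

/-- `n_{kl}(z)`, the number of (unordered) node pairs in block `(k, l)`. -/
noncomputable def blockPairs {N K : ℕ} (z : Fin N → Fin K) (k l : Fin K) : ℝ :=
  if k = l then (classSize z k : ℝ) * ((classSize z k : ℝ) - 1) / 2
  else (classSize z k : ℝ) * (classSize z l : ℝ)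

open Classical in
/-- `o_{kl}(z)`, the number of edges of `G` in block `(k, l)`; the double sum counts every edge
twice when `k = l`. -/
noncomputable def blockEdges {N K : ℕ} (G : SimpleGraph (Fin N)) (z : Fin N → Fin K)
    (k l : Fin K) : ℝ :=
  ∑ i with z i = k, ∑ j with z j = l,
    if k = l then G.adjMatrix ℝ i j / 2 else G.adjMatrix ℝ i j

/-- The profile log-likelihood `f(z) = ∑_{k ≤ l} n_{kl}(z) σ(o_{kl}(z) / n_{kl}(z))` of a single
layer `G`; a block without node pairs contributes `0`. -/
noncomputable def profileLogLik {N K : ℕ} (G : SimpleGraph (Fin N)) (z : Fin N → Fin K) : ℝ :=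
  ∑ k : Fin K, ∑ l : Fin K with k ≤ l,
    blockPairs z k l * sigma (blockEdges G z k l / blockPairs z k l)

/-- The set `argmax_z ∑_{t < T} f^t(z)` of all maximizers, over all assignments of the `N` nodes
to `K` classes, of the sum of the profile log-likelihoods of the first `T` layers. -/
def profileMLE {N : ℕ} (K : ℕ) (G : ℕ → SimpleGraph (Fin N)) (T : ℕ) : Set (Fin N → Fin K) :=
  {z | ∀ w : Fin N → Fin K, ∑ t ∈ Finset.range T, profileLogLik (G t) w ≤
    ∑ t ∈ Finset.range T, profileLogLik (G t) z}

/-- The random layers `G 0, G 1, …` follow the multi-graph stochastic block model with labels `c`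
and class connection probabilities `P`: all edge events, within and across layers, are
independent, and nodes `i ≠ j` are joined in layer `t` with probability `P^t_{c_i c_j}`. -/
structure IsMultiGraphSBM {Ω : Type*} [MeasurableSpace Ω] (μ : Measure Ω) {N K : ℕ}
    (c : Fin N → Fin K) (P : ℕ → Matrix (Fin K) (Fin K) ℝ)
    (G : ℕ → Ω → SimpleGraph (Fin N)) : Prop where
  measurableSet_edge : ∀ (t : ℕ) (i j : Fin N), MeasurableSet {ω | (G t ω).Adj i j}
  prob_edge : ∀ (t : ℕ) (i j : Fin N), i ≠ j → μ.real {ω | (G t ω).Adj i j} = P t (c i) (c j)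
  indep_edge : iIndepSet
    (fun e : ℕ × {p : Fin N × Fin N // p.1 < p.2} => {ω | (G e.1 ω).Adj e.2.1.1 e.2.1.2}) μ

end MultiSBM

/-! Fix a labelling `z` that is not a relabelling of `c`. The differences f^t(c) - f^t(z) are
independent over t and uniformly bounded, so if every mean is at least 1, Hoeffding's inequality and
Borel–Cantelli make their partial sums eventually positive (`ae_eventually_sum_pos`). There are
finitely many `z`, and relabellings of `c` tie with `c`.

For the means, replace edge indicators by their probabilities. Jensen's inequality says this
population value bounds the expectation from below, while a χ² bound on relative entropy together
with the variance of a block average shows that the expectation exceeds it by at most one per block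
(`integral_coloringLogLik_le`). The number of blocks depends on K alone.

The population gap between `c` and `z` is the sum over node pairs of the relative entropy of the
edge probability with respect to its `z`-block average. Some i, i' of different true classes share a
class of `z`. For every further node j of a class m separating them, the pairs ij and i'j lie in one
block, and their two divergences sum to at least the midpoint gap, hence to δ (`card_mul_gap_le`).
With s such nodes the gap is at least sδ, which beats the bias for s large in terms of K and δ. -/

namespace MultiSBM

/-! ### Bernoulli relative entropy -/

/-- The Bernoulli relative entropy, written as the Bregman divergence of `sigma`. -/
noncomputable def bregman (x p : ℝ) : ℝ :=
  sigma x - sigma p - (Real.log p - Real.log (1 - p)) * (x - p)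

lemma bregman_eq (x p : ℝ) : bregman x p =
    x * (Real.log x - Real.log p) + (1 - x) * (Real.log (1 - x) - Real.log (1 - p)) := by
  unfold bregman sigma; ring

lemma mul_log_sub_log_ge {x p : ℝ} (hx : 0 ≤ x) (hp : 0 < p) :
    x - p ≤ x * (Real.log x - Real.log p) := by
  rcases hx.eq_or_lt with rfl | hx
  · simp; exact hp.le
  · have h := Real.log_le_sub_one_of_pos (div_pos hp hx)
    rw [Real.log_div hp.ne' hx.ne'] at h
    have := mul_le_mul_of_nonneg_left h hx.le
    have e : x * (p / x - 1) = p - x := by field_simp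
    linarith [this]

lemma mul_log_sub_log_le {x p : ℝ} (hx : 0 ≤ x) (hp : 0 < p) :
    x * (Real.log x - Real.log p) ≤ x * (x / p - 1) := by
  rcases hx.eq_or_lt with rfl | hx
  · simp
  · rw [← Real.log_div hx.ne' hp.ne']
    exact mul_le_mul_of_nonneg_left (Real.log_le_sub_one_of_pos (div_pos hx hp)) hx.le

lemma bregman_nonneg {x p : ℝ} (hx : x ∈ Set.Icc (0 : ℝ) 1) (hp : p ∈ Set.Ioo (0 : ℝ) 1) :
    0 ≤ bregman x p := by
  rw [bregman_eq]
  have h1 := mul_log_sub_log_ge hx.1 hp.1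
  have h2 := mul_log_sub_log_ge (x := 1 - x) (p := 1 - p) (by linarith [hx.2]) (by linarith [hp.2])
  linarith

/-- Relative entropy is at most the χ² divergence, by `log y ≤ y - 1`. The denominator is the
Bernoulli variance, so it will cancel the variance of a block average exactly. -/
lemma bregman_le {x p : ℝ} (hx : x ∈ Set.Icc (0 : ℝ) 1) (hp : p ∈ Set.Ioo (0 : ℝ) 1) :
    bregman x p ≤ (x - p) ^ 2 / (p * (1 - p)) := by
  rw [bregman_eq]
  have hp1 : 0 < 1 - p := by linarith [hp.2]
  have h1 := mul_log_sub_log_le hx.1 hp.1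
  have h2 := mul_log_sub_log_le (x := 1 - x) (p := 1 - p) (by linarith [hx.2]) hp1
  have e : x * (x / p - 1) + (1 - x) * ((1 - x) / (1 - p) - 1) = (x - p) ^ 2 / (p * (1 - p)) := by
    have := hp.1.ne'
    field_simp
    ring
  linarith

/-- The right side exceeds the left by exactly twice the divergence of the midpoint from `x`: the
midpoint is the best common reference for `p` and `q`. -/
lemma sigma_midpoint_gap_le {p q x : ℝ} (hp : p ∈ Set.Icc (0 : ℝ) 1) (hq : q ∈ Set.Icc (0 : ℝ) 1)
    (hx : x ∈ Set.Ioo (0 : ℝ) 1) :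
    sigma p + sigma q - 2 * sigma ((p + q) / 2) ≤ bregman p x + bregman q x := by
  have h := bregman_nonneg (x := (p + q) / 2) (p := x)
    ⟨by linarith [hp.1, hq.1], by linarith [hp.2, hq.2]⟩ hx
  unfold bregman at *
  linarith

/-! ### Profile log-likelihood of an edge colouring -/

section Coloring

variable {E B : Type*} [Fintype E] [DecidableEq B]

/-- The edges of colour `β`. -/
def block (b : E → B) (β : B) : Finset E := Finset.univ.filter fun e => b e = β

/-- The average of `x` over the edges of colour `β`. -/
noncomputable def blockAvg (b : E → B) (β : B) (x : E → ℝ) : ℝ :=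
  (∑ e ∈ block b β, x e) / (block b β).card

/-- The profile log-likelihood of edge weights `x` for a colouring of the edges. -/
noncomputable def coloringLogLik [Fintype B] (b : E → B) (x : E → ℝ) : ℝ :=
  ∑ β, ((block b β).card : ℝ) * sigma (blockAvg b β x)

lemma card_mul_blockAvg (b : E → B) (β : B) (x : E → ℝ) :
    ((block b β).card : ℝ) * blockAvg b β x = ∑ e ∈ block b β, x e := by
  unfold blockAvg
  rcases (block b β).eq_empty_or_nonempty with h | h
  · simp [h]
  · have : ((block b β).card : ℝ) ≠ 0 := by exact_mod_cast h.card_pos.ne'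
    field_simp

lemma blockAvg_mem_Icc (b : E → B) (β : B) {x : E → ℝ} {u v : ℝ}
    (hβ : (block b β).Nonempty) (hx : ∀ e, x e ∈ Set.Icc u v) : blockAvg b β x ∈ Set.Icc u v := by
  have hc : (0 : ℝ) < (block b β).card := by exact_mod_cast hβ.card_pos
  unfold blockAvg
  constructor
  · rw [le_div_iff₀ hc]
    have := Finset.card_nsmul_le_sum (block b β) x u fun e _ => (hx e).1
    simpa [mul_comm] using this
  · rw [div_le_iff₀ hc]
    have := Finset.sum_le_card_nsmul (block b β) x v fun e _ => (hx e).2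
    simpa [mul_comm] using this

lemma sum_block [Fintype B] (b : E → B) (f : E → ℝ) : ∑ β, ∑ e ∈ block b β, f e = ∑ e, f e :=
  Finset.sum_fiberwise Finset.univ b f

/-- The population gap of a colouring is a sum of divergences from the block averages. -/
lemma sum_sigma_sub_coloringLogLik [Fintype B] (b : E → B) (p : E → ℝ) :
    ∑ e, sigma (p e) - coloringLogLik b p = ∑ e, bregman (p e) (blockAvg b (b e) p) := by
  unfold coloringLogLik
  rw [← sum_block b, ← sum_block b, ← Finset.sum_sub_distrib]
  refine Finset.sum_congr rfl fun β _ => ?_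
  have h : ∀ e ∈ block b β, bregman (p e) (blockAvg b (b e) p) = bregman (p e) (blockAvg b β p) := by
    intro e he
    rw [(Finset.mem_filter.1 he).2]
  rw [Finset.sum_congr rfl h]
  unfold bregman
  -- The linear terms cancel, since deviations from the block average sum to zero.
  rw [Finset.sum_sub_distrib, Finset.sum_sub_distrib, ← Finset.mul_sum, Finset.sum_sub_distrib,
    ← card_mul_blockAvg b β p]
  simp

lemma coloringLogLik_comp_equiv [Fintype B] (b : E → B) (φ : B ≃ B) (x : E → ℝ) :
    coloringLogLik (φ ∘ b) x = coloringLogLik b x := by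
  unfold coloringLogLik
  rw [← φ.sum_comp]
  refine Finset.sum_congr rfl fun β _ => ?_
  have : block (φ ∘ b) (φ β) = block b β := by
    ext e; simp [block]
  unfold blockAvg
  rw [this]

/-- Weights constant on blocks coincide with their block averages, so the true labels have no
population gap. -/
lemma coloringLogLik_eq_of_factor [Fintype B] (b : E → B) (q : B → ℝ) :
    coloringLogLik b (q ∘ b) = ∑ e, sigma (q (b e)) := by
  unfold coloringLogLik
  rw [← sum_block b]
  refine Finset.sum_congr rfl fun β _ => ?_
  have h : ∀ e ∈ block b β, sigma (q (b e)) = sigma (q β) := by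
    intro e he
    rw [(Finset.mem_filter.1 he).2]
  have h' : ∀ e ∈ block b β, (q ∘ b) e = q β := by
    intro e he
    simp [(Finset.mem_filter.1 he).2]
  rw [Finset.sum_congr rfl h, blockAvg, Finset.sum_congr rfl h']
  simp only [Finset.sum_const, nsmul_eq_mul]
  rcases (block b β).eq_empty_or_nonempty with h | h
  · simp [h]
  · have : ((block b β).card : ℝ) ≠ 0 := by exact_mod_cast h.card_pos.ne'
    congr 2
    field_simp

lemma continuous_sigma : Continuous sigma := by
  unfold sigma
  have h := Real.continuous_mul_log
  exact h.add (h.comp (continuous_const.sub continuous_id))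

lemma measurable_coloringLogLik [Fintype B] (b : E → B) : Measurable (coloringLogLik b) := by
  have := (continuous_sigma).measurable
  unfold coloringLogLik blockAvg
  fun_prop

/-- The profile log-likelihood is bounded on weights in `[0, 1]`. -/
lemma abs_coloringLogLik_le [Fintype B] (b : E → B) : ∃ M : ℝ, ∀ x : E → ℝ,
    (∀ e, x e ∈ Set.Icc (0 : ℝ) 1) → |coloringLogLik b x| ≤ M := by
  obtain ⟨S, hS⟩ := (isCompact_Icc (a := (0 : ℝ)) (b := 1)).exists_bound_of_continuousOn
    continuous_sigma.continuousOn
  refine ⟨∑ β, ((block b β).card : ℝ) * S, fun x hx => ?_⟩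
  refine (Finset.abs_sum_le_sum_abs _ _).trans (Finset.sum_le_sum fun β _ => ?_)
  rw [abs_mul, Nat.abs_cast]
  rcases (block b β).eq_empty_or_nonempty with h | h
  · simp [h]
  · exact mul_le_mul_of_nonneg_left (hS _ (blockAvg_mem_Icc b β h hx)) (Nat.cast_nonneg _)

end Coloring

/-! ### Edge indicators as random weights -/

section Weights

variable {Ω E : Type*}

/-- The `0`-`1` weights of a family of events. -/
noncomputable def weights (A : E → Set Ω) (ω : Ω) (e : E) : ℝ := (A e).indicator (fun _ => 1) ω

lemma weights_mem_Icc (A : E → Set Ω) (ω : Ω) (e : E) : weights A ω e ∈ Set.Icc (0 : ℝ) 1 := by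
  unfold weights
  by_cases h : ω ∈ A e <;> simp [h]

lemma measurable_weights [MeasurableSpace Ω] {A : E → Set Ω} (hA : ∀ e, MeasurableSet (A e)) :
    Measurable (weights A) :=
  measurable_pi_lambda _ fun e => measurable_const.indicator (hA e)

lemma memLp_weights [MeasurableSpace Ω] {μ : Measure Ω} [IsProbabilityMeasure μ]
    {A : E → Set Ω} (hA : ∀ e, MeasurableSet (A e)) (e : E) :
    MemLp (fun ω => weights A ω e) 2 μ := (memLp_const 1).indicator (hA e)

lemma iIndepFun_weights [MeasurableSpace Ω] {μ : Measure Ω} {A : E → Set Ω}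
    (hind : iIndepSet A μ) :
    iIndepFun (fun e ω => weights A ω e) μ := hind.iIndepFun_indicator

end Weights

/-! ### Expected versus population log-likelihood -/

section Expectation

variable {Ω E B : Type*} [MeasurableSpace Ω] {μ : Measure Ω} [IsProbabilityMeasure μ]
  [Fintype E] [DecidableEq B]

lemma variance_indicator {s : Set Ω} (hs : MeasurableSet s) :
    variance (s.indicator fun _ => (1 : ℝ)) μ = μ.real s * (1 - μ.real s) := by
  have hm : MemLp (s.indicator fun _ => (1 : ℝ)) 2 μ := (memLp_const 1).indicator hs
  rw [variance_eq_sub hm]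
  have : (s.indicator fun _ => (1 : ℝ)) ^ 2 = s.indicator fun _ => (1 : ℝ) := by
    ext ω; by_cases h : ω ∈ s <;> simp [h]
  rw [this, integral_indicator_const _ hs]
  simp; ring

lemma integrable_of_measurable_of_bound {f : Ω → ℝ} (hf : Measurable f) {M : ℝ}
    (h : ∀ ω, |f ω| ≤ M) : Integrable f μ :=
  Integrable.of_bound hf.aestronglyMeasurable M (Eventually.of_forall h)

lemma measurable_blockAvg_weights {A : E → Set Ω} (hA : ∀ e, MeasurableSet (A e)) (b : E → B)
    (β : B) : Measurable fun ω => blockAvg b β (weights A ω) := by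
  unfold blockAvg
  have := fun e => (measurable_pi_iff.1 (measurable_weights hA)) e
  fun_prop

lemma integrable_blockTerm {A : E → Set Ω} (hA : ∀ e, MeasurableSet (A e)) (b : E → B) (β : B) :
    Integrable (fun ω => ((block b β).card : ℝ) * sigma (blockAvg b β (weights A ω))) μ := by
  rcases (block b β).eq_empty_or_nonempty with h | h
  · simp [h]
  obtain ⟨S, hS⟩ := (isCompact_Icc (a := (0 : ℝ)) (b := 1)).exists_bound_of_continuousOn
    continuous_sigma.continuousOn
  exact (integrable_of_measurable_of_bound
    (continuous_sigma.measurable.comp (measurable_blockAvg_weights hA b β))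
    fun ω => hS _ (blockAvg_mem_Icc b β h (weights_mem_Icc A ω))).const_mul _

lemma integrable_blockAvg {A : E → Set Ω} (hA : ∀ e, MeasurableSet (A e)) (b : E → B) (β : B) :
    Integrable (fun ω => blockAvg b β (weights A ω)) μ := by
  unfold blockAvg
  refine Integrable.div_const (integrable_finsetSum _ fun e _ => ?_) _
  exact (integrable_const (1 : ℝ)).indicator (hA e)

lemma integral_blockAvg {A : E → Set Ω} (hA : ∀ e, MeasurableSet (A e)) (b : E → B) (β : B) :
    ∫ ω, blockAvg b β (weights A ω) ∂μ = blockAvg b β fun e => μ.real (A e) := by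
  unfold blockAvg weights
  rw [integral_div, integral_finsetSum _ fun e _ => (integrable_const (1 : ℝ)).indicator (hA e)]
  congr 1
  refine Finset.sum_congr rfl fun e _ => ?_
  rw [integral_indicator_const _ (hA e)]
  simp

lemma blockAvg_mem_Ioo (b : E → B) (β : B) {x : E → ℝ} (hβ : (block b β).Nonempty)
    (hx : ∀ e, x e ∈ Set.Ioo (0 : ℝ) 1) : blockAvg b β x ∈ Set.Ioo (0 : ℝ) 1 := by
  have hc : (0 : ℝ) < (block b β).card := by exact_mod_cast hβ.card_pos
  unfold blockAvg
  constructor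
  · exact div_pos (Finset.sum_pos (fun e _ => (hx e).1) hβ) hc
  · rw [div_lt_one hc]
    simpa using Finset.sum_lt_sum_of_nonempty hβ fun e _ => (hx e).2

/-- Jensen's inequality for the profile log-likelihood. -/
lemma coloringLogLik_le_integral [Fintype B] {A : E → Set Ω} (hA : ∀ e, MeasurableSet (A e))
    (hp : ∀ e, μ.real (A e) ∈ Set.Ioo (0 : ℝ) 1) (b : E → B) :
    coloringLogLik b (fun e => μ.real (A e)) ≤ ∫ ω, coloringLogLik b (weights A ω) ∂μ := by
  unfold coloringLogLik
  rw [integral_finsetSum _ fun β _ => integrable_blockTerm hA b β]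
  refine Finset.sum_le_sum fun β _ => ?_
  rcases (block b β).eq_empty_or_nonempty with h | h
  · simp [h]
  set n : ℝ := ((block b β).card : ℝ)
  have hm := blockAvg_mem_Ioo b β h hp
  set m := blockAvg b β fun e => μ.real (A e)
  have hY := integrable_blockAvg (μ := μ) hA b β
  have hint := integral_blockAvg (μ := μ) hA b β
  set s := Real.log m - Real.log (1 - m)
  have hlin : Integrable (fun ω => s * (blockAvg b β (weights A ω) - m)) μ :=
    (hY.sub (integrable_const _)).const_mul _
  -- The tangent line of `sigma` at the mean `m` lies below `sigma`, and its linear term integrates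
  -- to zero.
  calc n * sigma m
      = ∫ ω, n * (sigma m + s * (blockAvg b β (weights A ω) - m)) ∂μ := by
        rw [integral_const_mul, integral_add (integrable_const _) hlin, integral_const_mul,
          integral_sub hY (integrable_const _), hint]
        simp [m]
    _ ≤ _ := by
        refine integral_mono (((integrable_const _).add hlin).const_mul _)
          (integrable_blockTerm hA b β) fun ω => ?_
        refine mul_le_mul_of_nonneg_left ?_ (Nat.cast_nonneg _)
        have := bregman_nonneg (blockAvg_mem_Icc b β h (weights_mem_Icc A ω)) hm
        unfold bregman at this
        simp only [s]
        linarith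

lemma memLp_blockAvg {A : E → Set Ω} (hA : ∀ e, MeasurableSet (A e)) (b : E → B) (β : B) :
    MemLp (fun ω => blockAvg b β (weights A ω)) 2 μ := by
  have h : MemLp (fun ω => ∑ e ∈ block b β, weights A ω e) 2 μ :=
    memLp_finsetSum _ fun e _ => memLp_weights hA e
  simpa [blockAvg, div_eq_inv_mul] using h.const_mul ((block b β).card : ℝ)⁻¹

/-- Independence gives variance Σ p(1 - p) / n²; Cauchy–Schwarz on Σ p² then replaces the individual
probabilities by their average. -/
lemma variance_blockAvg_le {A : E → Set Ω} (hA : ∀ e, MeasurableSet (A e))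
    (hind : iIndepSet A μ) (b : E → B) (β : B) :
    (block b β).card * variance (fun ω => blockAvg b β (weights A ω)) μ ≤
      blockAvg b β (fun e => μ.real (A e)) * (1 - blockAvg b β (fun e => μ.real (A e))) := by
  rcases (block b β).eq_empty_or_nonempty with h | h
  · simp [h, blockAvg]
  have hc : (0 : ℝ) < (block b β).card := by exact_mod_cast h.card_pos
  have hvar : variance (fun ω => blockAvg b β (weights A ω)) μ =
      ((block b β).card : ℝ)⁻¹ ^ 2 * ∑ e ∈ block b β, μ.real (A e) * (1 - μ.real (A e)) := by
    have : (fun ω => blockAvg b β (weights A ω)) =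
        fun ω => ((block b β).card : ℝ)⁻¹ * (∑ e ∈ block b β, fun ω => weights A ω e) ω := by
      ext ω; simp [blockAvg, div_eq_inv_mul]
    rw [this, variance_const_mul, IndepFun.variance_sum (fun e _ => memLp_weights hA e)
      fun e _ e' _ hne => (iIndepFun_weights hind).indepFun hne]
    congr 1
    exact Finset.sum_congr rfl fun e _ => variance_indicator (hA e)
  rw [hvar]
  have hcs := sq_sum_le_card_mul_sum_sq (s := block b β) (f := fun e => μ.real (A e))
  simp only [mul_sub, mul_one, Finset.sum_sub_distrib, blockAvg, ← sq]
  set n : ℝ := ((block b β).card : ℝ)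
  set S := ∑ e ∈ block b β, μ.real (A e)
  set Q := ∑ e ∈ block b β, μ.real (A e) ^ 2
  have e1 : n * (n⁻¹ ^ 2 * S) - n * (n⁻¹ ^ 2 * Q) = S / n - (n * Q) / n ^ 2 := by
    field_simp
  rw [e1, div_pow]
  gcongr

/-- The bias of the profile log-likelihood is at most one per block. -/
lemma integral_coloringLogLik_le [Fintype B] {A : E → Set Ω} (hA : ∀ e, MeasurableSet (A e))
    (hp : ∀ e, μ.real (A e) ∈ Set.Ioo (0 : ℝ) 1) (hind : iIndepSet A μ) (b : E → B) :
    ∫ ω, coloringLogLik b (weights A ω) ∂μ ≤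
      coloringLogLik b (fun e => μ.real (A e)) + Fintype.card B := by
  unfold coloringLogLik
  rw [integral_finsetSum _ fun β _ => integrable_blockTerm hA b β, ← Finset.card_univ,
    Finset.cast_card, ← Finset.sum_add_distrib]
  refine Finset.sum_le_sum fun β _ => ?_
  rcases (block b β).eq_empty_or_nonempty with h | h
  · simp [h]
  have hvar := variance_blockAvg_le (μ := μ) hA hind b β
  set n : ℝ := ((block b β).card : ℝ)
  have hm := blockAvg_mem_Ioo b β h hp
  have hY := integrable_blockAvg (μ := μ) hA b β
  have hY2 := memLp_blockAvg (μ := μ) hA b β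
  have hint := integral_blockAvg (μ := μ) hA b β
  rw [variance_eq_integral hY2.aemeasurable, hint] at hvar
  set m := blockAvg b β fun e => μ.real (A e)
  have hmm : 0 < m * (1 - m) := mul_pos hm.1 (by linarith [hm.2])
  set s := Real.log m - Real.log (1 - m)
  have hlin : Integrable (fun ω => s * (blockAvg b β (weights A ω) - m)) μ :=
    (hY.sub (integrable_const _)).const_mul _
  have hsq : Integrable (fun ω => (blockAvg b β (weights A ω) - m) ^ 2 / (m * (1 - m))) μ :=
    ((hY2.sub (memLp_const m)).integrable_sq).div_const _
  -- Tangent line plus quadratic remainder; only the remainder survives as bias, and it is n times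
  -- the variance over m(1 - m).
  calc ∫ ω, n * sigma (blockAvg b β (weights A ω)) ∂μ
      ≤ ∫ ω, n * (sigma m + s * (blockAvg b β (weights A ω) - m) +
          (blockAvg b β (weights A ω) - m) ^ 2 / (m * (1 - m))) ∂μ := by
        refine integral_mono (integrable_blockTerm hA b β)
          ((((integrable_const _).add hlin).add hsq).const_mul _) fun ω => ?_
        refine mul_le_mul_of_nonneg_left ?_ (Nat.cast_nonneg _)
        have := bregman_le (blockAvg_mem_Icc b β h (weights_mem_Icc A ω)) hm
        unfold bregman at this
        simp only [s]
        linarith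
    _ = n * sigma m + n * (∫ ω, (blockAvg b β (weights A ω) - m) ^ 2 ∂μ) / (m * (1 - m)) := by
        have h1 : Integrable (fun ω => sigma m + s * (blockAvg b β (weights A ω) - m)) μ :=
          (integrable_const _).add hlin
        rw [integral_const_mul, integral_add h1 hsq, integral_add (integrable_const _) hlin,
          integral_const_mul, integral_sub hY (integrable_const _), hint, integral_div]
        simp [m]
        ring
    _ ≤ _ := by
        gcongr
        exact (div_le_one hmm).2 hvar

end Expectation
-- From node labellings to colourings of node pairs; the population gap
section Graph

variable {N K : ℕ}

/-- The node pairs `i < j`. -/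
abbrev NodePair (N : ℕ) : Type := {p : Fin N × Fin N // p.1 < p.2}

/-- The block of a node pair under the assignment `z`. -/
def pairBlock (z : Fin N → Fin K) (e : NodePair N) : Sym2 (Fin K) := s(z e.1.1, z e.1.2)

lemma sum_sum_eq_sum_nodePair (f : Fin N → Fin N → ℝ) (hf : ∀ i, f i i = 0) :
    ∑ i, ∑ j, f i j = ∑ e : NodePair N, (f e.1.1 e.1.2 + f e.1.2 e.1.1) := by
  have key : ∀ g : Fin N → Fin N → ℝ,
      ∑ e : NodePair N, g e.1.1 e.1.2 = ∑ i, ∑ j, if i < j then g i j else 0 := by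
    intro g
    rw [← Fintype.sum_prod_type', ← Finset.sum_filter]
    exact (Finset.sum_subtype _ (by simp) fun p : Fin N × Fin N => g p.1 p.2).symm
  rw [Finset.sum_add_distrib, key f, key fun i j => f j i,
    Finset.sum_comm (f := fun i j => if i < j then f j i else 0), ← Finset.sum_add_distrib]
  refine Finset.sum_congr rfl fun i _ => ?_
  rw [← Finset.sum_add_distrib]
  refine Finset.sum_congr rfl fun j _ => ?_
  rcases lt_trichotomy i j with h | rfl | h
  · simp [h, h.not_gt]
  · simp [hf]
  · simp [h, h.not_gt]

/-- Inside a diagonal block each unordered pair occurs in both orders, hence the halving. Adjacency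
weights give edge counts; weight 1 off the diagonal gives pair counts. -/
lemma sum_class_eq_sum_block (z : Fin N → Fin K) (k l : Fin K) (w : Fin N → Fin N → ℝ)
    (hw : ∀ i j, w i j = w j i) (hw0 : ∀ i, w i i = 0) :
    ∑ i with z i = k, ∑ j with z j = l, (if k = l then w i j / 2 else w i j) =
      ∑ e ∈ block (pairBlock z) s(k, l), w e.1.1 e.1.2 := by
  simp only [block, Finset.sum_filter]
  have h1 : ∀ i, (if z i = k then ∑ j, if z j = l then (if k = l then w i j / 2 else w i j) else 0
      else 0) = ∑ j, if z i = k ∧ z j = l then (if k = l then w i j / 2 else w i j) else 0 := by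
    intro i
    by_cases h : z i = k <;> simp [h]
  simp only [h1]
  rw [sum_sum_eq_sum_nodePair _ (by simp [hw0])]
  refine Finset.sum_congr rfl fun e _ => ?_
  rw [hw e.1.2 e.1.1]
  unfold pairBlock
  simp only [Sym2.eq_iff]
  by_cases hkl : k = l
  · subst hkl
    by_cases h1 : z e.1.1 = k <;> by_cases h2 : z e.1.2 = k <;> simp [h1, h2]
  · by_cases h1 : z e.1.1 = k <;> by_cases h2 : z e.1.2 = l <;> by_cases h3 : z e.1.1 = l <;>
      by_cases h4 : z e.1.2 = k <;> simp_all

open Classical in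
lemma blockEdges_eq (G : SimpleGraph (Fin N)) (z : Fin N → Fin K) (k l : Fin K) :
    blockEdges G z k l = ∑ e ∈ block (pairBlock z) s(k, l), G.adjMatrix ℝ e.1.1 e.1.2 :=
  sum_class_eq_sum_block z k l _ (fun i j => by simp [G.adj_comm]) (by simp)

lemma blockPairs_eq (z : Fin N → Fin K) (k l : Fin K) :
    blockPairs z k l = (block (pairBlock z) s(k, l)).card := by
  have h := sum_class_eq_sum_block z k l (fun i j => if i = j then 0 else 1)
    (fun i j => by simp [eq_comm]) (by simp)
  have h' : ∀ e ∈ block (pairBlock z) s(k, l),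
      (if e.1.1 = e.1.2 then (0 : ℝ) else 1) = 1 := fun e _ => if_neg e.2.ne
  rw [Finset.sum_congr rfl h'] at h
  simp only [Finset.sum_const, nsmul_eq_mul, mul_one] at h
  rw [← h]
  unfold blockPairs classSize
  by_cases hkl : k = l
  · subst hkl
    simp only [if_true]
    have h1 : ∀ i ∈ Finset.univ.filter (fun i => z i = k),
        ∑ j with z j = k, (if i = j then (0 : ℝ) else 1) / 2 =
          (((Finset.univ.filter fun i => z i = k).card : ℝ) - 1) / 2 := by
      intro i hi
      rw [← Finset.sum_div]
      congr 1
      have : ∀ j, (if i = j then (0 : ℝ) else 1) = 1 - if i = j then 1 else 0 := by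
        intro j; split_ifs <;> simp
      simp only [this, Finset.sum_sub_distrib, Finset.sum_ite_eq, hi]
      simp
    rw [Finset.sum_congr rfl h1]
    simp only [Finset.sum_const, nsmul_eq_mul]
    ring
  · simp only [if_neg hkl]
    have h1 : ∀ i ∈ Finset.univ.filter (fun i => z i = k),
        ∑ j with z j = l, (if i = j then (0 : ℝ) else 1) =
          ((Finset.univ.filter fun i => z i = l).card : ℝ) := by
      intro i hi
      rw [Finset.sum_congr rfl (g := fun _ => (1 : ℝ))]
      · simp
      · intro j hj
        refine if_neg ?_
        rintro rfl
        exact hkl ((Finset.mem_filter.1 hi).2.symm.trans (Finset.mem_filter.1 hj).2)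
    rw [Finset.sum_congr rfl h1]
    simp

open Classical in
lemma profileLogLik_eq (G : SimpleGraph (Fin N)) (z : Fin N → Fin K) :
    profileLogLik G z =
      coloringLogLik (pairBlock z) fun e => G.adjMatrix ℝ e.1.1 e.1.2 := by
  unfold profileLogLik coloringLogLik blockAvg
  simp only [blockPairs_eq, blockEdges_eq]
  set F : Sym2 (Fin K) → ℝ := fun β => ((block (pairBlock z) β).card : ℝ) *
    sigma ((∑ e ∈ block (pairBlock z) β, G.adjMatrix ℝ e.1.1 e.1.2) /
      (block (pairBlock z) β).card)
  change ∑ k, ∑ l with k ≤ l, F s(k, l) = ∑ β, F β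
  simp only [Finset.sum_filter]
  -- Sorting identifies unordered pairs of classes with the pairs k ≤ l.
  rw [← Sym2.sortEquiv.symm.sum_comp F, ← Fintype.sum_prod_type', ← Finset.sum_filter]
  exact Finset.sum_subtype _ (by simp) fun p : Fin K × Fin K => F s(p.1, p.2)

lemma profileLogLik_perm_comp (G : SimpleGraph (Fin N)) (π : Equiv.Perm (Fin K))
    (c : Fin N → Fin K) : profileLogLik G (π ∘ c) = profileLogLik G c := by
  rw [profileLogLik_eq, profileLogLik_eq]
  exact coloringLogLik_comp_equiv (pairBlock c) (Equiv.ofBijective (Sym2.map π)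
    (Finite.injective_iff_bijective.1 (Sym2.map.injective π.injective))) _

/-- If two nodes of different classes share a block, then the nodes of a class `m` that share a
block each contribute to the population gap. -/
lemma card_mul_gap_le (Q : Matrix (Fin K) (Fin K) ℝ) (hQ : Q.IsSymm)
    (hQ01 : ∀ k l, Q k l ∈ Set.Ioo (0 : ℝ) 1) (c z : Fin N → Fin K) {i i' : Fin N} (hne : i ≠ i')
    (hz : z i = z i') {m l : Fin K} {S : Finset (Fin N)} (hi : i ∉ S) (hi' : i' ∉ S)
    (hS : ∀ j ∈ S, c j = m ∧ z j = l) :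
    (S.card : ℝ) * (sigma (Q (c i) m) + sigma (Q (c i') m) -
        2 * sigma ((Q (c i) m + Q (c i') m) / 2)) ≤
      ∑ e : NodePair N, sigma (Q (c e.1.1) (c e.1.2)) -
        coloringLogLik (pairBlock z) fun e => Q (c e.1.1) (c e.1.2) := by
  rw [sum_sigma_sub_coloringLogLik (pairBlock z) fun e : NodePair N => Q (c e.1.1) (c e.1.2)]
  set a : Sym2 (Fin K) → ℝ := fun β => blockAvg (pairBlock z) β fun e => Q (c e.1.1) (c e.1.2)
  have ha : ∀ i j : Fin N, i ≠ j → a s(z i, z j) ∈ Set.Ioo (0 : ℝ) 1 := by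
    intro i j hij
    refine blockAvg_mem_Ioo _ _ ?_ fun e => hQ01 _ _
    rcases hij.lt_or_gt with h | h
    · exact ⟨⟨(i, j), h⟩, by simp [block, pairBlock]⟩
    · exact ⟨⟨(j, i), h⟩, by simp [block, pairBlock]⟩
  -- Divergences over ordered pairs, with zero diagonal: each node pair counts twice, whence the
  -- factors 2 below.
  set D : Fin N → Fin N → ℝ := fun i j =>
    if i = j then 0 else bregman (Q (c i) (c j)) (a s(z i, z j)) with hD
  have hDnn : ∀ i j, 0 ≤ D i j := by
    intro i j
    simp only [hD]
    split_ifs with h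
    · exact le_rfl
    · exact bregman_nonneg (Set.Ioo_subset_Icc_self (hQ01 _ _)) (ha i j h)
  have hDsymm : ∀ i j, D i j = D j i := by
    intro i j
    simp only [hD, eq_comm (a := i), Sym2.eq_swap (a := z i), hQ.apply (c i) (c j)]
  have hsum : 2 * ∑ e : NodePair N, bregman (Q (c e.1.1) (c e.1.2)) (a (pairBlock z e)) =
      ∑ i, ∑ j, D i j := by
    rw [sum_sum_eq_sum_nodePair D (by simp [hD]), Finset.mul_sum]
    refine Finset.sum_congr rfl fun e _ => ?_
    rw [hDsymm e.1.2 e.1.1]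
    simp only [hD, if_neg e.2.ne, pairBlock]
    ring
  have hdisj : Disjoint (({i, i'} : Finset (Fin N)) ×ˢ S) (S ×ˢ ({i, i'} : Finset (Fin N))) := by
    rw [Finset.disjoint_left]
    rintro ⟨x, y⟩ h1 h2
    simp only [Finset.mem_product, Finset.mem_insert, Finset.mem_singleton] at h1 h2
    rcases h1.1 with rfl | rfl
    · exact hi h2.1
    · exact hi' h2.1
  have hle : 2 * ∑ j ∈ S, (D i j + D i' j) ≤ ∑ i, ∑ j, D i j := by
    rw [← Fintype.sum_prod_type']
    calc 2 * ∑ j ∈ S, (D i j + D i' j)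
        = ∑ x ∈ ({i, i'} ×ˢ S) ∪ (S ×ˢ {i, i'}), D x.1 x.2 := by
          rw [Finset.sum_union hdisj, Finset.sum_product, Finset.sum_product,
            Finset.sum_pair hne, ← Finset.sum_add_distrib, two_mul]
          congr 1
          refine Finset.sum_congr rfl fun j _ => ?_
          rw [Finset.sum_pair hne, hDsymm j, hDsymm j]
      _ ≤ _ := Finset.sum_le_sum_of_subset_of_nonneg (Finset.subset_univ _)
          fun x _ _ => hDnn x.1 x.2
  have hpt : ∀ j ∈ S, sigma (Q (c i) m) + sigma (Q (c i') m) -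
      2 * sigma ((Q (c i) m + Q (c i') m) / 2) ≤ D i j + D i' j := by
    intro j hj
    have hij : i ≠ j := fun h => hi (h ▸ hj)
    have hij' : i' ≠ j := fun h => hi' (h ▸ hj)
    -- As `z i = z i'`, both divergences are taken from the same block average.
    simp only [hD, if_neg hij, if_neg hij', (hS j hj).1, ← hz]
    exact sigma_midpoint_gap_le (Set.Ioo_subset_Icc_self (hQ01 _ _))
      (Set.Ioo_subset_Icc_self (hQ01 _ _)) (ha i j hij)
  have := Finset.card_nsmul_le_sum S _ _ hpt
  rw [nsmul_eq_mul] at this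
  linarith

/-- An assignment whose classes refine those of a surjective `c` is a relabelling of `c`. -/
lemma exists_perm_of_refines {c z : Fin N → Fin K} (hc : Function.Surjective c)
    (h : ∀ i i', z i = z i' → c i = c i') : ∃ π : Equiv.Perm (Fin K), z = π ∘ c := by
  obtain ⟨r, hr⟩ := hc.hasRightInverse
  -- `r` picks one node per true class; an injective self-map of the finite label set is a
  -- permutation.
  have hinj : Function.Injective (z ∘ r) := fun k k' hk => by
    have := h _ _ hk
    rwa [hr, hr] at this
  have hbij := Finite.injective_iff_bijective.1 hinj
  refine ⟨Equiv.ofBijective _ hbij, funext fun i => ?_⟩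
  obtain ⟨k, hk⟩ := hbij.2 (z i)
  have := h _ _ hk
  rw [hr] at this
  subst this
  exact hk.symm

lemma le_classSize_of_le_minClassSize {c : Fin N → Fin K} {n : ℕ} (h : n ≤ minClassSize c)
    (k : Fin K) : n ≤ classSize c k := h.trans (ciInf_le' _ k)

/-- A class with at least `K s + 2` nodes has `s` nodes other than `i, i'` in a common class
of `z`. -/
lemma exists_common_class (c z : Fin N → Fin K) (i i' : Fin N) (m : Fin K) {s : ℕ}
    (h : K * s + 2 ≤ classSize c m) :
    ∃ (l : Fin K) (S : Finset (Fin N)), i ∉ S ∧ i' ∉ S ∧ (∀ j ∈ S, c j = m ∧ z j = l) ∧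
      s ≤ S.card := by
  set S₀ := (Finset.univ.filter fun j => c j = m) \ {i, i'} with hS₀
  have hcard : K * s ≤ S₀.card := by
    have h1 := Finset.le_card_sdiff ({i, i'} : Finset (Fin N)) (Finset.univ.filter fun j => c j = m)
    have h2 : ({i, i'} : Finset (Fin N)).card ≤ 2 := Finset.card_le_two
    unfold classSize at h
    rw [hS₀]
    omega
  have : Nonempty (Fin K) := ⟨m⟩
  obtain ⟨l, -, hl⟩ := Finset.exists_le_card_fiber_of_mul_le_card_of_maps_to (s := S₀)
    (t := Finset.univ) (f := z) (n := s) (by simp) Finset.univ_nonempty (by simpa using hcard)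
  refine ⟨l, S₀.filter fun j => z j = l, ?_, ?_, ?_, hl⟩
  · simp [hS₀]
  · simp [hS₀]
  · intro j hj
    simp only [hS₀, Finset.mem_filter, Finset.mem_sdiff, Finset.mem_univ, true_and] at hj
    exact ⟨hj.1.1, hj.2⟩

lemma entry_mem_Ioo {P : ℕ → Matrix (Fin K) (Fin K) ℝ} {C₀ : ℝ} (hC₀ : 0 < C₀)
    (h : (C₀ : EReal) ≤ entryMargin P) (t : ℕ) (k l : Fin K) : P t k l ∈ Set.Ioo (0 : ℝ) 1 := by
  have h1 : (C₀ : EReal) ≤ ((min (P t k l) (1 - P t k l) : ℝ) : EReal) :=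
    h.trans ((iInf_le _ t).trans ((iInf_le _ k).trans (iInf_le _ l)))
  have h2 := lt_min_iff.1 (hC₀.trans_le (EReal.coe_le_coe_iff.1 h1))
  exact ⟨h2.1, by linarith [h2.2]⟩

/-- The supremum over the finitely many classes is attained. The class `m` may change with the
layer. -/
lemma exists_separating_class {P : ℕ → Matrix (Fin K) (Fin K) ℝ} {δ : ℝ}
    (h : (δ : EReal) ≤ separation P) (t : ℕ) {k l : Fin K} (hkl : k ≠ l) :
    ∃ m, δ ≤ sigma (P t k m) + sigma (P t l m) - 2 * sigma ((P t k m + P t l m) / 2) := by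
  have : Nonempty (Fin K) := ⟨k⟩
  have h1 := h.trans ((iInf_le _ t).trans ((iInf_le _ k).trans ((iInf_le _ l).trans
    (iInf_le _ hkl))))
  obtain ⟨m, hm⟩ := exists_eq_ciSup_of_finite (f := fun m : Fin K =>
    ((sigma (P t k m) + sigma (P t l m) - 2 * sigma ((P t k m + P t l m) / 2) : ℝ) : EReal))
  rw [← hm] at h1
  exact ⟨m, EReal.coe_le_coe_iff.1 h1⟩

end Graph
-- Almost sure positivity of partial sums; independence of layers
section Limit

variable {Ω : Type*} [MeasurableSpace Ω] {μ : Measure Ω} [IsProbabilityMeasure μ]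

/-- Partial sums of independent, uniformly bounded variables with means at least one are almost
surely eventually positive. -/
lemma ae_eventually_sum_pos {Y : ℕ → Ω → ℝ} (hY : ∀ t, Measurable (Y t)) {M : ℝ}
    (hM : ∀ t ω, |Y t ω| ≤ M) (hind : iIndepFun Y μ) (hmean : ∀ t, 1 ≤ ∫ ω, Y t ω ∂μ) :
    ∀ᵐ ω ∂μ, ∀ᶠ T : ℕ in atTop, 0 < ∑ t ∈ Finset.range T, Y t ω := by
  -- Hoeffding's variance proxy for the interval [-(|M| + 1), |M| + 1]; the added 1 keeps it
  -- positive when M = 0.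
  set κ : NNReal := (‖(|M| + 1) - (-(|M| + 1))‖₊ / 2) ^ 2
  have hκ : 0 < κ := by
    have : 0 < (|M| + 1) - (-(|M| + 1)) := by linarith [abs_nonneg M]
    exact pow_pos (div_pos (nnnorm_pos.2 this.ne') two_pos) 2
  set Z : ℕ → Ω → ℝ := fun t ω => -(Y t ω - ∫ ω, Y t ω ∂μ) with hZ
  have hsub : ∀ t, HasSubgaussianMGF (Z t) κ μ := by
    intro t
    exact (hasSubgaussianMGF_of_mem_Icc (hY t).aemeasurable (Eventually.of_forall fun ω =>
      Set.mem_Icc.2 (abs_le.1 ((hM t ω).trans (by linarith [le_abs_self M]))))).neg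
  have hZind : iIndepFun Z μ :=
    hind.comp (fun t x => -(x - ∫ ω, Y t ω ∂μ)) fun t => by fun_prop
  -- The sum falls below its mean by at least T. Since that mean is at least T, the sum is positive
  -- off this event.
  set s : ℕ → Set Ω := fun T => {ω | (T : ℝ) ≤ ∑ t ∈ Finset.range T, Z t ω}
  have hbound : ∀ T, μ.real (s T) ≤ Real.exp (T * (-(1 / (2 * (κ : ℝ))))) := by
    intro T
    refine (HasSubgaussianMGF.measure_sum_range_ge_le_of_iIndepFun hZind (fun t _ => hsub t)
      (Nat.cast_nonneg T)).trans (Real.exp_le_exp.2 (le_of_eq ?_))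
    have : (κ : ℝ) ≠ 0 := by positivity
    rcases Nat.eq_zero_or_pos T with rfl | hT
    · simp
    · have : (T : ℝ) ≠ 0 := by positivity
      field_simp
  have hsummable : Summable fun T => μ.real (s T) :=
    Summable.of_nonneg_of_le (fun _ => measureReal_nonneg) hbound
      (Real.summable_exp_nat_mul_iff.2 (by
        have : 0 < 1 / (2 * (κ : ℝ)) := by positivity
        linarith))
  have hfin : ∑' T, μ (s T) ≠ ⊤ := by
    have := hsummable.tsum_ofReal_ne_top
    simpa [ofReal_measureReal] using this
  -- Borel–Cantelli: almost surely only finitely many of the events occur.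
  filter_upwards [ae_eventually_notMem hfin] with ω hω
  filter_upwards [hω] with T hT
  simp only [s, Set.mem_ofPred_eq, not_le, hZ, Finset.sum_neg_distrib, Finset.sum_sub_distrib] at hT
  have := Finset.card_nsmul_le_sum (Finset.range T) (fun t => ∫ ω, Y t ω ∂μ) 1 fun t _ => hmean t
  simp at this
  linarith

/-- The rows of an independent array are independent. -/
lemma iIndepFun_rows {ι E β : Type*} [MeasurableSpace β]
    {X : ι × E → Ω → β} (hX : ∀ i, Measurable (X i)) (hind : iIndepFun X μ) :
    iIndepFun (fun i ω (e : E) => X (i, e) ω) μ := by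
  have hsig : iIndepFun (fun (p : (_ : ι) × E) ω => X (p.1, p.2) ω) μ :=
    hind.precomp (Equiv.sigmaEquivProd ι E).injective
  have hrow : ∀ i, iIndepFun (fun e => X (i, e)) μ := fun i =>
    hind.precomp (g := fun e : E => (i, e)) fun _ _ h => (Prod.ext_iff.1 h).2
  have : ∀ i e, IsProbabilityMeasure (μ.map (X (i, e))) :=
    fun i e => Measure.isProbabilityMeasure_map (hX _).aemeasurable
  have : ∀ i, IsProbabilityMeasure (μ.map fun ω (e : E) => X (i, e) ω) :=
    fun i => Measure.isProbabilityMeasure_map (Measurable.aemeasurable (by fun_prop))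
  have hcurry : (MeasurableEquiv.piCurry fun (_ : ι) (_ : E) => β) ∘
      (fun ω (p : (_ : ι) × E) => X (p.1, p.2) ω) = fun ω i e => X (i, e) ω := by
    ext; simp [Sigma.curry]
  -- Independence means that the joint law is a product; currying turns the product over the array
  -- into a product of row laws.
  rw [iIndepFun_iff_map_fun_eq_infinitePi_map (by fun_prop), ← hcurry,
    ← Measure.map_map (by fun_prop) (by fun_prop),
    (iIndepFun_iff_map_fun_eq_infinitePi_map (by fun_prop)).1 hsig,
    Measure.infinitePi_map_piCurry (fun i e => μ.map (X (i, e)))]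
  congrm Measure.infinitePi fun i => ?_
  rw [(iIndepFun_iff_map_fun_eq_infinitePi_map (by fun_prop)).1 (hrow i)]

end Limit

/-! ### Expected advantage of the true labels in one layer -/

section Model

variable {Ω : Type*} [MeasurableSpace Ω] {μ : Measure Ω} {N K : ℕ}
  {c : Fin N → Fin K} {P : ℕ → Matrix (Fin K) (Fin K) ℝ} {G : ℕ → Ω → SimpleGraph (Fin N)}

/-- The event that a node pair is joined in layer `t`. -/
def edgeEvent {Ω : Type*} (G : ℕ → Ω → SimpleGraph (Fin N)) (t : ℕ) (e : NodePair N) : Set Ω :=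
  {ω | (G t ω).Adj e.1.1 e.1.2}

lemma profileLogLik_eq_weights {Ω : Type*} {G : ℕ → Ω → SimpleGraph (Fin N)}
    (t : ℕ) (ω : Ω) (z : Fin N → Fin K) :
    profileLogLik (G t ω) z = coloringLogLik (pairBlock z) (weights (edgeEvent G t) ω) := by
  classical
  rw [profileLogLik_eq]
  congr 1

lemma IsMultiGraphSBM.measurableSet_edgeEvent (hG : IsMultiGraphSBM μ c P G) (t : ℕ)
    (e : NodePair N) : MeasurableSet (edgeEvent G t e) := hG.measurableSet_edge t _ _

lemma IsMultiGraphSBM.real_edgeEvent (hG : IsMultiGraphSBM μ c P G) (t : ℕ) (e : NodePair N) :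
    μ.real (edgeEvent G t e) = P t (c e.1.1) (c e.1.2) := hG.prob_edge t _ _ e.2.ne

lemma IsMultiGraphSBM.iIndepSet_edgeEvent (hG : IsMultiGraphSBM μ c P G) (t : ℕ) :
    iIndepSet (edgeEvent G t) μ :=
  iIndepSet.precomp (g := fun e : NodePair N => (t, e)) (fun _ _ h => (Prod.ext_iff.1 h).2)
    hG.indep_edge

lemma IsMultiGraphSBM.iIndepFun_weights [IsProbabilityMeasure μ] (hG : IsMultiGraphSBM μ c P G) :
    iIndepFun (fun t => weights (edgeEvent G t)) μ :=
  iIndepFun_rows (X := fun i : ℕ × NodePair N => (edgeEvent G i.1 i.2).indicator fun _ => (1 : ℝ))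
    (fun i => measurable_const.indicator (hG.measurableSet_edgeEvent i.1 i.2))
    hG.indep_edge.iIndepFun_indicator

/-- The expected advantage of the true labels is at least the population gap minus one per
block. -/
lemma integral_coloringLogLik_sub_ge [IsProbabilityMeasure μ] (hG : IsMultiGraphSBM μ c P G) {t : ℕ}
    (hsymm : (P t).IsSymm) (hP : ∀ k l, P t k l ∈ Set.Ioo (0 : ℝ) 1) (z : Fin N → Fin K) :
    ∑ e : NodePair N, sigma (P t (c e.1.1) (c e.1.2)) -
        coloringLogLik (pairBlock z) (fun e => P t (c e.1.1) (c e.1.2)) -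
        Fintype.card (Sym2 (Fin K)) ≤
      ∫ ω, (coloringLogLik (pairBlock c) (weights (edgeEvent G t) ω) -
        coloringLogLik (pairBlock z) (weights (edgeEvent G t) ω)) ∂μ := by
  have hA := hG.measurableSet_edgeEvent t
  have hp : (fun e => μ.real (edgeEvent G t e)) = fun e => P t (c e.1.1) (c e.1.2) :=
    funext (hG.real_edgeEvent t)
  have hp01 : ∀ e, μ.real (edgeEvent G t e) ∈ Set.Ioo (0 : ℝ) 1 := fun e => by
    rw [hG.real_edgeEvent]; exact hP _ _
  have hint : ∀ w : Fin N → Fin K,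
      Integrable (fun ω => coloringLogLik (pairBlock w) (weights (edgeEvent G t) ω)) μ :=
    fun w => integrable_finsetSum _ fun β _ => integrable_blockTerm hA _ β
  rw [integral_sub (hint c) (hint z)]
  have h1 := coloringLogLik_le_integral hA hp01 (pairBlock c)
  have h2 := integral_coloringLogLik_le hA hp01 (hG.iIndepSet_edgeEvent t) (pairBlock z)
  rw [hp] at h1 h2
  -- Edge probabilities are constant on the blocks of `c`; symmetry of `P t` lets them descend to
  -- unordered pairs of classes.
  have h3 : coloringLogLik (pairBlock c) (fun e => P t (c e.1.1) (c e.1.2)) =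
      ∑ e : NodePair N, sigma (P t (c e.1.1) (c e.1.2)) :=
    coloringLogLik_eq_of_factor (pairBlock c)
      (Sym2.lift ⟨fun k l => P t k l, fun k l => (hsymm.apply k l).symm⟩)
  linarith

end Model
end MultiSBM

/-! ### Consistency of the maximizer -/

theorem theorem2 (K : ℕ) (hK : 1 ≤ K) (C₀ δ : ℝ) (hC₀ : 0 < C₀) (hδ : 0 < δ) :
    ∃ m₀ : ℕ, ∀ (N : ℕ) (c : Fin N → Fin K) (P : ℕ → Matrix (Fin K) (Fin K) ℝ)
      (Ω : Type*) [MeasurableSpace Ω] (μ : Measure Ω) [IsProbabilityMeasure μ]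
      (G : ℕ → Ω → SimpleGraph (Fin N)),
      (∀ t, (P t).IsSymm) →
      (C₀ : EReal) ≤ MultiSBM.entryMargin P →
      (δ : EReal) ≤ MultiSBM.separation P →
      m₀ ≤ MultiSBM.minClassSize c →
      MultiSBM.IsMultiGraphSBM μ c P G →
      ∀ᵐ ω ∂μ, ∀ᶠ T : ℕ in atTop,
        MultiSBM.profileMLE K (fun t => G t ω) T =
          {z | ∃ π : Equiv.Perm (Fin K), z = π ∘ c} := by
  open MultiSBM in
  -- So that s δ covers the bias of one per block and leaves a mean of at least 1.
  obtain ⟨s, hs⟩ := exists_nat_ge (((Fintype.card (Sym2 (Fin K)) : ℝ) + 1) / δ)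
  rw [div_le_iff₀ hδ] at hs
  -- K s nodes for the pigeonhole principle, and 2 for discarding i and i'. The 2 also forces every
  -- true class to be nonempty.
  refine ⟨K * s + 2, fun N c P Ω _ μ _ G hsymm hP hsep hmin hG => ?_⟩
  have hP01 := entry_mem_Ioo hC₀ hP
  have hsize := le_classSize_of_le_minClassSize hmin
  have hsurj : Function.Surjective c := fun k => by
    have : 0 < classSize c k := by have := hsize k; omega
    obtain ⟨i, hi⟩ := Finset.card_pos.1 this
    exact ⟨i, (Finset.mem_filter.1 hi).2⟩
  have hlt : ∀ z : Fin N → Fin K, (¬ ∃ π : Equiv.Perm (Fin K), z = π ∘ c) →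
      ∀ᵐ ω ∂μ, ∀ᶠ T : ℕ in atTop, ∑ t ∈ Finset.range T, profileLogLik (G t ω) z <
        ∑ t ∈ Finset.range T, profileLogLik (G t ω) c := by
    intro z hz
    obtain ⟨i, i', hzi, hci⟩ : ∃ i i', z i = z i' ∧ c i ≠ c i' := by
      by_contra! h
      exact hz (exists_perm_of_refines hsurj h)
    obtain ⟨M, hM⟩ := abs_coloringLogLik_le (pairBlock c)
    obtain ⟨M', hM'⟩ := abs_coloringLogLik_le (pairBlock z)
    have hmeas : Measurable fun x : NodePair N → ℝ =>
        coloringLogLik (pairBlock c) x - coloringLogLik (pairBlock z) x :=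
      (measurable_coloringLogLik _).sub (measurable_coloringLogLik _)
    have key := ae_eventually_sum_pos (μ := μ) (M := M + M')
      (Y := fun t ω => coloringLogLik (pairBlock c) (weights (edgeEvent G t) ω) -
        coloringLogLik (pairBlock z) (weights (edgeEvent G t) ω))
      (fun t => hmeas.comp (measurable_weights (hG.measurableSet_edgeEvent t)))
      (fun t ω => (abs_sub _ _).trans
        (add_le_add (hM _ (weights_mem_Icc _ ω)) (hM' _ (weights_mem_Icc _ ω))))
      (hG.iIndepFun_weights.comp (fun _ x =>
        coloringLogLik (pairBlock c) x - coloringLogLik (pairBlock z) x) fun _ => hmeas) ?_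
    · filter_upwards [key] with ω hω
      filter_upwards [hω] with T hT
      simp only [profileLogLik_eq_weights]
      rw [Finset.sum_sub_distrib] at hT
      linarith
    · intro t
      obtain ⟨m, hm⟩ := exists_separating_class hsep t hci
      obtain ⟨l, S, hi, hi', hS, hcard⟩ := exists_common_class c z i i' m (hsize m)
      have h1 := card_mul_gap_le (P t) (hsymm t) (hP01 t) c z (ne_of_apply_ne c hci) hzi hi hi' hS
      have h2 := integral_coloringLogLik_sub_ge hG (hsymm t) (hP01 t) z
      have h3 : (s : ℝ) * δ ≤ S.card * (sigma (P t (c i) m) + sigma (P t (c i') m) -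
          2 * sigma ((P t (c i) m + P t (c i') m) / 2)) := by
        have : (s : ℝ) ≤ S.card := by exact_mod_cast hcard
        gcongr
      linarith
  have hall : ∀ᵐ ω ∂μ, ∀ z : Fin N → Fin K, (¬ ∃ π : Equiv.Perm (Fin K), z = π ∘ c) →
      ∀ᶠ T : ℕ in atTop, ∑ t ∈ Finset.range T, profileLogLik (G t ω) z <
        ∑ t ∈ Finset.range T, profileLogLik (G t ω) c := by
    rw [ae_all_iff]
    intro z
    by_cases hz : ∃ π : Equiv.Perm (Fin K), z = π ∘ c
    · exact Eventually.of_forall fun ω h => absurd hz h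
    · filter_upwards [hlt z hz] with ω hω _ using hω
  filter_upwards [hall] with ω hω
  have hω' : ∀ᶠ T : ℕ in atTop, ∀ z : Fin N → Fin K,
      (¬ ∃ π : Equiv.Perm (Fin K), z = π ∘ c) →
      ∑ t ∈ Finset.range T, profileLogLik (G t ω) z <
        ∑ t ∈ Finset.range T, profileLogLik (G t ω) c := by
    -- A single threshold T serves all `z` because there are finitely many labellings.
    rw [eventually_all]
    intro z
    by_cases hz : ∃ π : Equiv.Perm (Fin K), z = π ∘ c
    · exact Eventually.of_forall fun T h => absurd hz h
    · filter_upwards [hω z hz] with T hT _ using hT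
  filter_upwards [hω'] with T hT
  ext z
  constructor
  · intro hz
    by_contra h
    exact (hT z h).not_ge (hz c)
  · rintro ⟨π, rfl⟩ w
    simp only [profileLogLik_perm_comp]
    by_cases hw : ∃ π : Equiv.Perm (Fin K), w = π ∘ c
    · obtain ⟨ρ, rfl⟩ := hw
      simp only [profileLogLik_perm_comp, le_refl]
    · exact (hT w hw).le
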